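/- Let $\Bbbk$ be a field and let $I$ be a binomial ideal in $\Bbbk[x]=\Bbbk[x_1,\dots,x_n]$ (an ideal generated by polynomials with at most two terms) which is cellular: every variable $x_i$ is either a nonzerodivisor or nilpotent modulo $I$. Let $\Delta\subseteq\{1,\dots,n\}$ be the set of indices of the variables that are nonzerodivisors modulo $I$, let $\Delta^c$ be its complement, and write $\Bbbk[\mathbb N^\Delta]=\Bbbk[x_i\mid i\in\Delta]$, $\Bbbk[\mathbb N^{\Delta^c}]=\Bbbk[x_i\mid i\in\Delta^c]$. A partial character $\rho$ on $\mathbb Z^\Delta$ is a group homomorphism $\rho:L_\rho\to\Bbbk^*$ from a subgroup $L_\rho\subseteq\mathbb Z^\Delta$; its lattice ideal is $I(\rho)=\langle x^u-\rho(u-v)x^v\mid u,v\in\mathbb N^\Delta,\ u-v\in L_\rho\rangle\subseteq\Bbbk[\mathbb N^\Delta]$. A lattice $L\subseteq\mathbb Z^\Delta$ is associated to $I$, with witness monomial $m\in\Bbbk[\mathbb N^{\Delta^c}]$, if $(I:m)\cap\Bbbk[\mathbb N^\Delta]=I(\tau)$ for some partial character $\tau:L\to\Bbbk^*$; it is embedded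 if moreover $\operatorname{rank}(L)>\operatorname{rank}(L_\rho)$, where $\rho$ is the partial character on $\mathbb Z^\Delta$ with $I\cap\Bbbk[\mathbb N^\Delta]=I(\rho)$. Let $\operatorname{Memb}(I)\subseteq\Bbbk[x]$ be the ideal generated by all witness monomials of embedded associated lattices to $I$ (so $\operatorname{Memb}(I)=0$ if there are none, in particular if $I=\Bbbk[x]$). Then every monomial $x^\mu$, $\mu\in\mathbb N^n$, that belongs to $I+\operatorname{Memb}(I)$ belongs to $I$ or to $\operatorname{Memb}(I)$. -/

import Mathlib

open MvPolynomial

noncomputable section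

namespace CellularBinomial

/-- A binomial is a polynomial with at most two terms. -/
def IsBinomial {σ K : Type*} [Field K] (p : MvPolynomial σ K) : Prop :=
  p.support.card ≤ 2

/-- A binomial ideal is an ideal generated by binomials. -/
def IsBinomialIdeal {σ K : Type*} [Field K] (I : Ideal (MvPolynomial σ K)) : Prop :=
  ∃ S : Set (MvPolynomial σ K), (∀ p ∈ S, IsBinomial p) ∧ I = Ideal.span S

/-- A partial character on `ℤ^σ`: a subgroup `L` of `ℤ^σ` together with a group
homomorphism from `L` to the multiplicative group of `K`. -/
structure PartialCharacter (σ K : Type*) [Field K] where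
  lattice : AddSubgroup (σ → ℤ)
  char : Multiplicative lattice →* Kˣ

/-- The difference `u - v` in `ℤ^σ` of two exponent vectors `u, v` in `ℕ^σ`. -/
def expDiff {σ : Type*} (u v : σ →₀ ℕ) : σ → ℤ := fun i => (u i : ℤ) - (v i : ℤ)

/-- The lattice ideal `I(ρ) = ⟨x^u - ρ(u - v) x^v | u - v ∈ L_ρ⟩` of `K[x_i | i ∈ σ]`. -/
def latticeIdeal {σ K : Type*} [Field K] (ρ : PartialCharacter σ K) :
    Ideal (MvPolynomial σ K) :=
  Ideal.span {p | ∃ (u v : σ →₀ ℕ) (h : expDiff u v ∈ ρ.lattice),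
    p = monomial u (1 : K) -
      monomial v ((ρ.char (Multiplicative.ofAdd ⟨expDiff u v, h⟩) : Kˣ) : K)}

/-- The rank of a lattice in `ℤ^σ`. -/
def latticeRank {σ : Type*} (L : AddSubgroup (σ → ℤ)) : ℕ := Module.finrank ℤ L

/-- An ideal is cellular if every variable is a nonzerodivisor or nilpotent modulo it. -/
def IsCellular {σ K : Type*} [Field K] (I : Ideal (MvPolynomial σ K)) : Prop :=
  ∀ i : σ, Ideal.Quotient.mk I (X i) ∈ nonZeroDivisors (MvPolynomial σ K ⧸ I) ∨
    IsNilpotent (Ideal.Quotient.mk I (X i))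

/-- The set `Δ` of (indices of) variables that are nonzerodivisors modulo `I`. -/
def cellularVars {σ K : Type*} [Field K] (I : Ideal (MvPolynomial σ K)) : Set σ :=
  {i | Ideal.Quotient.mk I (X i) ∈ nonZeroDivisors (MvPolynomial σ K ⧸ I)}

/-- The contraction `J ∩ K[ℕ^Δ]`, as an ideal of `K[ℕ^Δ] = K[x_i | i ∈ Δ]`. -/
def contract {σ K : Type*} [Field K] (Δ : Set σ) (J : Ideal (MvPolynomial σ K)) :
    Ideal (MvPolynomial Δ K) :=
  J.comap (rename (R := K) (Subtype.val : Δ → σ))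

/-- The monomial `x^w` lies in `K[ℕ^{Δᶜ}]` and it witnesses that the lattice `L ⊆ ℤ^Δ` is
associated to `I`: one has `(I : x^w) ∩ K[ℕ^Δ] = I(τ)` for some partial character `τ`
defined on `L`. Here `Δ` is the set of cellular variables of `I`. -/
def IsWitness {σ K : Type*} [Field K] (I : Ideal (MvPolynomial σ K))
    (L : AddSubgroup (cellularVars I → ℤ)) (w : σ →₀ ℕ) : Prop :=
  (∀ i ∈ cellularVars I, w i = 0) ∧
  ∃ τ : PartialCharacter (cellularVars I) K, τ.lattice = L ∧
    contract (cellularVars I) (Submodule.colon I {monomial w (1 : K)}) = latticeIdeal τ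

/-- A lattice `L` associated to `I` is embedded if `rank L > rank L_ρ`, where `ρ` is the
partial character on `ℤ^Δ` with `I ∩ K[ℕ^Δ] = I(ρ)`. -/
def IsEmbeddedLattice {σ K : Type*} [Field K] (I : Ideal (MvPolynomial σ K))
    (L : AddSubgroup (cellularVars I → ℤ)) : Prop :=
  (∃ w : σ →₀ ℕ, IsWitness I L w) ∧
  ∃ ρ : PartialCharacter (cellularVars I) K,
    contract (cellularVars I) I = latticeIdeal ρ ∧ latticeRank ρ.lattice < latticeRank L

/-- The ideal generated by the witness monomials of the embedded associated lattices to `I`. -/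
def Memb {σ K : Type*} [Field K] (I : Ideal (MvPolynomial σ K)) :
    Ideal (MvPolynomial σ K) :=
  Ideal.span {m | ∃ (L : AddSubgroup (cellularVars I → ℤ)) (w : σ →₀ ℕ),
    IsEmbeddedLattice I L ∧ IsWitness I L w ∧ m = monomial w (1 : K)}

end CellularBinomial

end

open MvPolynomial

namespace CellularBinomial

/-! ### A linear functional that kills a binomial ideal and detects one monomial class -/

section Functional

variable {σ K : Type*} [Field K]

/-! Let `x^μ ∉ I`. Call two monomials proportional if they agree modulo `I` up to a nonzero scalar.
Reading off the scalars on the class of `x^μ`, and 0 elsewhere, gives a linear functional that kills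
every binomial of `I`, hence `I`, and takes the value 1 at `x^μ`
(`IsBinomialIdeal.classFunctional_eq_zero`). Applied to `x^μ = f + g` with `f ∈ I` and `g ∈ Memb I`,
it yields a term `x^v` of `g` proportional to `x^μ`.

As `Memb I` is a monomial ideal, an embedded witness `x^w` divides `x^v`. Let `x^{w'}` be the part
of `x^μ` in the variables outside `Δ`. If `x^w p ∈ I` with `p ∈ K[ℕ^Δ]`, then `x^v p`, `x^μ p` and
finally `x^{w'} p` lie in `I`, so the contracted colon ideal of `w` is contained in that of `w'`.
The latter is again a lattice ideal (`IsBinomialIdeal.exists_contract_colon_eq_latticeIdeal`), and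
its lattice contains the old one, so its rank is still too large for `L_ρ`. Thus `x^{w'}` is an
embedded witness dividing `x^μ`. -/

/-- The scalar `c ≠ 0` with `x^u ≡ c x^μ` modulo `I`, or `0` if there is none. -/
noncomputable def classCoeff (I : Ideal (MvPolynomial σ K)) (μ u : σ →₀ ℕ) : K := by
  classical exact
    if h : ∃ c : K, c ≠ 0 ∧ monomial u (1 : K) - monomial μ c ∈ I then h.choose else 0

lemma monomial_mem_of_monomial_mem {I : Ideal (MvPolynomial σ K)} {u : σ →₀ ℕ} {c : K}
    (hc : c ≠ 0) (h : monomial u c ∈ I) (d : K) : monomial u d ∈ I := by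
  have := I.mul_mem_left (C (d * c⁻¹)) h
  rwa [C_mul_monomial, mul_assoc, inv_mul_cancel₀ hc, mul_one] at this

lemma classCoeff_spec {I : Ideal (MvPolynomial σ K)} {μ u : σ →₀ ℕ}
    (h : classCoeff I μ u ≠ 0) :
    monomial u (1 : K) - monomial μ (classCoeff I μ u) ∈ I := by
  classical
  unfold classCoeff at h ⊢
  split_ifs at h ⊢ with h'
  · exact h'.choose_spec.2
  · exact absurd rfl h

/-- Subtracting leaves `(d - c) x^μ ∈ I`. This makes the scalar chosen in `classCoeff` independent
of the choice. -/
lemma eq_of_sub_monomial_mem {I : Ideal (MvPolynomial σ K)} {f : MvPolynomial σ K}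
    {μ : σ →₀ ℕ} (hμ : monomial μ (1 : K) ∉ I) {c d : K}
    (hc : f - monomial μ c ∈ I) (hd : f - monomial μ d ∈ I) : c = d := by
  by_contra hne
  apply hμ
  refine monomial_mem_of_monomial_mem (c := d - c) (sub_ne_zero.mpr (Ne.symm hne)) ?_ 1
  have := I.sub_mem hc hd
  rwa [sub_sub_sub_cancel_left, ← map_sub] at this

lemma classCoeff_eq {I : Ideal (MvPolynomial σ K)} {μ u : σ →₀ ℕ}
    (hμ : monomial μ (1 : K) ∉ I) {c : K} (hc : c ≠ 0)
    (h : monomial u (1 : K) - monomial μ c ∈ I) : classCoeff I μ u = c := by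
  classical
  have h' : ∃ c : K, c ≠ 0 ∧ monomial u (1 : K) - monomial μ c ∈ I := ⟨c, hc, h⟩
  unfold classCoeff
  rw [dif_pos h']
  exact eq_of_sub_monomial_mem hμ h'.choose_spec.2 h

lemma classCoeff_self {I : Ideal (MvPolynomial σ K)} {μ : σ →₀ ℕ}
    (hμ : monomial μ (1 : K) ∉ I) : classCoeff I μ μ = 1 :=
  classCoeff_eq hμ one_ne_zero (by simp)

lemma classCoeff_eq_zero {I : Ideal (MvPolynomial σ K)} {μ u : σ →₀ ℕ}
    (hμ : monomial μ (1 : K) ∉ I) (hu : monomial u (1 : K) ∈ I) : classCoeff I μ u = 0 := by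
  by_contra h
  refine hμ (monomial_mem_of_monomial_mem h ?_ 1)
  simpa using I.sub_mem hu (classCoeff_spec h)

/-- The binomial makes `x^v` proportional to `x^u`, so both lie in the class of `x^μ` and their
scalars are tied by the same relation. -/
lemma classCoeff_eq_of_binomial_mem {I : Ideal (MvPolynomial σ K)} {μ u v : σ →₀ ℕ}
    (hμ : monomial μ (1 : K) ∉ I) {c d : K} (hc : c ≠ 0) (hd : d ≠ 0)
    (h : monomial u c + monomial v d ∈ I) (hu : classCoeff I μ u ≠ 0) :
    c * classCoeff I μ u + d * classCoeff I μ v = 0 := by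
  have key : classCoeff I μ v = -(d⁻¹ * c * classCoeff I μ u) := by
    refine classCoeff_eq hμ
      (neg_ne_zero.mpr (mul_ne_zero (mul_ne_zero (inv_ne_zero hd) hc) hu)) ?_
    have h1 := I.mul_mem_left (C d⁻¹) h
    have h2 := I.mul_mem_left (C (d⁻¹ * c)) (classCoeff_spec hu)
    rw [mul_add, C_mul_monomial, C_mul_monomial, inv_mul_cancel₀ hd] at h1
    rw [mul_sub, C_mul_monomial, C_mul_monomial, mul_one] at h2
    have h3 := I.sub_mem h1 h2
    rw [map_neg]
    convert h3 using 1
    ring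
  rw [key]
  field_simp
  ring

/-- The linear functional sending `x^u` to `c` if `x^u ≡ c x^μ` modulo `I`. -/
noncomputable def classFunctional (I : Ideal (MvPolynomial σ K)) (μ : σ →₀ ℕ) :
    MvPolynomial σ K →ₗ[K] K :=
  (basisMonomials σ K).constr K (classCoeff I μ)

lemma classFunctional_monomial (I : Ideal (MvPolynomial σ K)) (μ u : σ →₀ ℕ) (c : K) :
    classFunctional I μ (monomial u c) = c * classCoeff I μ u := by
  have h : monomial u c = c • basisMonomials σ K u := by
    simp [coe_basisMonomials, smul_monomial]
  rw [h, map_smul, classFunctional, Module.Basis.constr_basis, smul_eq_mul]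

lemma classFunctional_apply (I : Ideal (MvPolynomial σ K)) (μ : σ →₀ ℕ)
    (f : MvPolynomial σ K) :
    classFunctional I μ f = ∑ u ∈ f.support, f.coeff u * classCoeff I μ u := by
  conv_lhs => rw [f.as_sum, map_sum]
  exact Finset.sum_congr rfl fun u _ => classFunctional_monomial I μ u _

lemma classFunctional_eq_zero_of_isBinomial {I : Ideal (MvPolynomial σ K)} {μ : σ →₀ ℕ}
    (hμ : monomial μ (1 : K) ∉ I) {f : MvPolynomial σ K} (hf : f ∈ I) (hb : IsBinomial f) :
    classFunctional I μ f = 0 := by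
  classical
  rw [classFunctional_apply]
  have hsum := f.as_sum
  unfold IsBinomial at hb
  interval_cases hcard : f.support.card
  · rw [Finset.card_eq_zero] at hcard
    simp [hcard]
  · obtain ⟨u, hu⟩ := Finset.card_eq_one.mp hcard
    have hne : f.coeff u ≠ 0 := mem_support_iff.mp (by simp [hu])
    rw [hu, Finset.sum_singleton] at hsum ⊢
    rw [hsum] at hf
    rw [classCoeff_eq_zero hμ (monomial_mem_of_monomial_mem hne hf 1), mul_zero]
  · obtain ⟨u, v, huv, hs⟩ := Finset.card_eq_two.mp hcard
    have hu : f.coeff u ≠ 0 := mem_support_iff.mp (by simp [hs])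
    have hv : f.coeff v ≠ 0 := mem_support_iff.mp (by simp [hs])
    rw [hs, Finset.sum_pair huv] at hsum ⊢
    rw [hsum] at hf
    by_cases h1 : classCoeff I μ u = 0
    · by_cases h2 : classCoeff I μ v = 0
      · simp [h1, h2]
      · rw [add_comm] at hf ⊢
        exact classCoeff_eq_of_binomial_mem hμ hv hu hf h2
    · exact classCoeff_eq_of_binomial_mem hμ hu hv hf h1

lemma IsBinomial.monomial_mul {f : MvPolynomial σ K} (hf : IsBinomial f) (a : σ →₀ ℕ)
    (c : K) : IsBinomial (monomial a c * f) := by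
  classical
  refine le_trans (Finset.card_le_card (support_mul _ _)) ?_
  refine le_trans (Finset.card_add_le) ?_
  have h1 : (monomial a c : MvPolynomial σ K).support.card ≤ 1 := by
    simpa using Finset.card_le_card (support_monomial_subset (s := a) (a := c))
  calc _ ≤ 1 * f.support.card := Nat.mul_le_mul_right _ h1
    _ ≤ 2 := by rw [one_mul]; exact hf

lemma IsBinomialIdeal.classFunctional_eq_zero {I : Ideal (MvPolynomial σ K)}
    (hI : IsBinomialIdeal I) {μ : σ →₀ ℕ} (hμ : monomial μ (1 : K) ∉ I)
    {f : MvPolynomial σ K} (hf : f ∈ I) : classFunctional I μ f = 0 := by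
  obtain ⟨S, hS, hIS⟩ := hI
  -- The functional is only `K`-linear, so the induction over the span must carry all multiples `p *
  -- f`; monomial multiples of binomials are again binomials.
  suffices h : ∀ f ∈ Ideal.span S, ∀ p : MvPolynomial σ K, classFunctional I μ (p * f) = 0 by
    simpa using h f (hIS ▸ hf) 1
  intro f hf
  refine Submodule.span_induction ?_ ?_ ?_ ?_ hf
  · intro b hb p
    induction p using MvPolynomial.induction_on' with
    | monomial a c =>
      refine classFunctional_eq_zero_of_isBinomial hμ (I.mul_mem_left _ ?_)
        ((hS b hb).monomial_mul a c)
      rw [hIS]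
      exact Ideal.subset_span hb
    | add p q hp hq => rw [add_mul, map_add, hp, hq, add_zero]
  · simp
  · intro x y _ _ hx hy p
    rw [mul_add, map_add, hx, hy, add_zero]
  · intro q x _ hx p
    rw [smul_eq_mul, ← mul_assoc]
    exact hx _

/-- Modulo a binomial ideal, every term of a member of the ideal is either in the ideal or
proportional to another term of that member. -/
lemma IsBinomialIdeal.exists_sub_mem {I : Ideal (MvPolynomial σ K)}
    (hI : IsBinomialIdeal I) {f : MvPolynomial σ K} (hf : f ∈ I) {μ : σ →₀ ℕ}
    (hμ : monomial μ (1 : K) ∉ I) (hμf : μ ∈ f.support) :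
    ∃ v ∈ f.support, v ≠ μ ∧ ∃ c : K, c ≠ 0 ∧ monomial v (1 : K) - monomial μ c ∈ I := by
  classical
  have h := hI.classFunctional_eq_zero hμ hf
  rw [classFunctional_apply, ← Finset.add_sum_erase _ _ hμf, classCoeff_self hμ, mul_one] at h
  -- The term at `μ` contributes its nonzero coefficient to a vanishing sum, so another term must
  -- lie in the same class.
  have hne : ∑ u ∈ f.support.erase μ, f.coeff u * classCoeff I μ u ≠ 0 := by
    intro h0
    rw [h0, add_zero] at h
    exact mem_support_iff.mp hμf h
  obtain ⟨v, hv, hv0⟩ := Finset.exists_ne_zero_of_sum_ne_zero hne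
  have hv1 := right_ne_zero_of_mul hv0
  exact ⟨v, Finset.mem_of_mem_erase hv, Finset.ne_of_mem_erase hv, _, hv1, classCoeff_spec hv1⟩

/-- A monomial of `I + M`, with `I` binomial, is in `I` or is proportional modulo `I` to a
term of a member of `M`. -/
lemma IsBinomialIdeal.exists_of_mem_sup {I M : Ideal (MvPolynomial σ K)}
    (hI : IsBinomialIdeal I) {μ : σ →₀ ℕ} (hμ : monomial μ (1 : K) ∉ I)
    (h : monomial μ (1 : K) ∈ I ⊔ M) :
    ∃ g ∈ M, ∃ v ∈ g.support, ∃ c : K, c ≠ 0 ∧ monomial v (1 : K) - monomial μ c ∈ I := by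
  obtain ⟨f, hf, g, hg, hfg⟩ := Submodule.mem_sup.mp h
  have h1 := congrArg (classFunctional I μ) hfg
  rw [map_add, hI.classFunctional_eq_zero hμ hf, zero_add, classFunctional_monomial,
    classCoeff_self hμ, mul_one, classFunctional_apply] at h1
  obtain ⟨v, hv, hv0⟩ := Finset.exists_ne_zero_of_sum_ne_zero (h1.trans_ne one_ne_zero)
  have hv1 := right_ne_zero_of_mul hv0
  exact ⟨g, hg, v, hv, _, hv1, classCoeff_spec hv1⟩

end Functional

/-! ### Lattice ideals and monomial-saturated ideals -/

section Lattice

variable {σ K : Type*} [Field K]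

lemma expDiff_eq_expDiff_iff {u v u' v' : σ →₀ ℕ} :
    expDiff u v = expDiff u' v' ↔ u + v' = u' + v := by
  constructor
  · intro h
    ext i
    have := congrFun h i
    simp only [expDiff, Finsupp.add_apply] at this ⊢
    omega
  · intro h
    funext i
    have := DFunLike.congr_fun h i
    simp only [expDiff, Finsupp.add_apply] at this ⊢
    omega

lemma expDiff_self (u : σ →₀ ℕ) : expDiff u u = 0 := by
  funext i
  simp [expDiff]

lemma expDiff_swap (u v : σ →₀ ℕ) : expDiff v u = -expDiff u v := by
  funext i
  simp [expDiff]

lemma expDiff_add (u v u' v' : σ →₀ ℕ) :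
    expDiff (u + u') (v + v') = expDiff u v + expDiff u' v' := by
  funext i
  simp only [expDiff, Finsupp.add_apply, Pi.add_apply]
  push_cast
  ring

/-- An ideal modulo which every monomial is a nonzerodivisor. -/
def IsMonomialSaturated (J : Ideal (MvPolynomial σ K)) : Prop :=
  ∀ (a : σ →₀ ℕ) (f : MvPolynomial σ K), monomial a (1 : K) * f ∈ J → f ∈ J

lemma IsMonomialSaturated.monomial_notMem {J : Ideal (MvPolynomial σ K)}
    (hJ : IsMonomialSaturated J) (h1 : J ≠ ⊤) (u : σ →₀ ℕ) : monomial u (1 : K) ∉ J := by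
  intro h
  refine h1 ((Ideal.eq_top_iff_one J).mpr (hJ u 1 ?_))
  rwa [mul_one]

lemma binomial_mem_add {J : Ideal (MvPolynomial σ K)} {u v u' v' : σ →₀ ℕ} {c c' : K}
    (h : monomial u (1 : K) - monomial v c ∈ J)
    (h' : monomial u' (1 : K) - monomial v' c' ∈ J) :
    monomial (u + u') (1 : K) - monomial (v + v') (c * c') ∈ J := by
  have h1 := J.mul_mem_left (monomial u' (1 : K)) h
  have h2 := J.mul_mem_left (monomial v c) h'
  rw [mul_sub, monomial_mul, monomial_mul] at h1 h2
  have h3 := J.add_mem h1 h2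
  simp only [mul_one, one_mul] at h3
  convert h3 using 1
  rw [add_comm u u', add_comm v u']
  ring

lemma binomial_mem_swap {J : Ideal (MvPolynomial σ K)} {u v : σ →₀ ℕ} {c : Kˣ}
    (h : monomial u (1 : K) - monomial v (c : K) ∈ J) :
    monomial v (1 : K) - monomial u ((c⁻¹ : Kˣ) : K) ∈ J := by
  have h1 := J.neg_mem (J.mul_mem_left (C ((c⁻¹ : Kˣ) : K)) h)
  rw [mul_sub, C_mul_monomial, C_mul_monomial, neg_sub, mul_one, Units.inv_mul] at h1
  exact h1

/-- Since `u + v' = u' + v`, one has `x^v (x^{u'} - c x^{v'}) = x^{v'} (x^u - c x^v)`, and `x^v` can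
be cancelled. So membership depends only on `u - v` and `c`. -/
lemma IsMonomialSaturated.binomial_mem_of_expDiff_eq {J : Ideal (MvPolynomial σ K)}
    (hJ : IsMonomialSaturated J) {u v u' v' : σ →₀ ℕ} {c : K}
    (h : monomial u (1 : K) - monomial v c ∈ J) (hd : expDiff u v = expDiff u' v') :
    monomial u' (1 : K) - monomial v' c ∈ J := by
  rw [expDiff_eq_expDiff_iff] at hd
  refine hJ v _ ?_
  have h1 := J.mul_mem_left (monomial v' (1 : K)) h
  rw [mul_sub, monomial_mul, monomial_mul] at h1 ⊢
  rwa [add_comm v' u, hd, add_comm u' v, add_comm v' v] at h1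

/-- The differences `u - v` of exponents of binomials `x^u - c x^v` in `J`, `c ≠ 0`. -/
def binomialLattice (J : Ideal (MvPolynomial σ K)) : AddSubgroup (σ → ℤ) where
  carrier := {d | ∃ (u v : σ →₀ ℕ) (c : Kˣ), expDiff u v = d ∧
    monomial u (1 : K) - monomial v (c : K) ∈ J}
  zero_mem' := ⟨0, 0, 1, expDiff_self 0, by simp⟩
  add_mem' := by
    rintro _ _ ⟨u, v, c, rfl, h⟩ ⟨u', v', c', rfl, h'⟩
    refine ⟨u + u', v + v', c * c', expDiff_add _ _ _ _, ?_⟩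
    rw [Units.val_mul]
    exact binomial_mem_add h h'
  neg_mem' := by
    rintro _ ⟨u, v, c, rfl, h⟩
    exact ⟨v, u, c⁻¹, expDiff_swap u v, binomial_mem_swap h⟩

/-- The coefficient `c` of a binomial `x^u - c x^v` in `J` with given `u - v`. -/
noncomputable def binomialCoeff (J : Ideal (MvPolynomial σ K)) (d : binomialLattice J) : Kˣ :=
  d.2.choose_spec.choose_spec.choose

lemma IsMonomialSaturated.binomial_mem {J : Ideal (MvPolynomial σ K)}
    (hJ : IsMonomialSaturated J) (d : binomialLattice J) {u v : σ →₀ ℕ}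
    (h : expDiff u v = d) :
    monomial u (1 : K) - monomial v (binomialCoeff J d : K) ∈ J := by
  have hs := d.2.choose_spec.choose_spec.choose_spec
  exact hJ.binomial_mem_of_expDiff_eq hs.2 (hs.1.trans h.symm)

lemma IsMonomialSaturated.binomialCoeff_eq {J : Ideal (MvPolynomial σ K)}
    (hJ : IsMonomialSaturated J) (h1 : J ≠ ⊤) (d : binomialLattice J) {u v : σ →₀ ℕ} {c : Kˣ}
    (h : expDiff u v = d) (hc : monomial u (1 : K) - monomial v (c : K) ∈ J) :
    binomialCoeff J d = c :=
  Units.ext (eq_of_sub_monomial_mem (hJ.monomial_notMem h1 v) (hJ.binomial_mem d h) hc)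

/-- The partial character of a proper ideal modulo which monomials are nonzerodivisors. -/
noncomputable def IsMonomialSaturated.partialCharacter {J : Ideal (MvPolynomial σ K)}
    (hJ : IsMonomialSaturated J) (h1 : J ≠ ⊤) : PartialCharacter σ K where
  lattice := binomialLattice J
  char := MonoidHom.mk' (fun d => binomialCoeff J d.toAdd) <| by
    intro d d'
    obtain ⟨u, v, c, h, hc⟩ := d.toAdd.2
    obtain ⟨u', v', c', h', hc'⟩ := d'.toAdd.2
    rw [hJ.binomialCoeff_eq h1 d.toAdd h hc, hJ.binomialCoeff_eq h1 d'.toAdd h' hc']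
    refine hJ.binomialCoeff_eq h1 _ (u := u + u') (v := v + v') ?_ ?_
    · rw [expDiff_add, h, h']
      rfl
    · rw [Units.val_mul]
      exact binomial_mem_add hc hc'

/-- If every term of every member of `J` is proportional modulo `J` to another term, then `J`
is a lattice ideal. -/
lemma IsMonomialSaturated.eq_latticeIdeal {J : Ideal (MvPolynomial σ K)}
    (hJ : IsMonomialSaturated J) (h1 : J ≠ ⊤)
    (hterm : ∀ f ∈ J, ∀ u ∈ f.support, ∃ v ∈ f.support, v ≠ u ∧ ∃ c : K, c ≠ 0 ∧
      monomial v (1 : K) - monomial u c ∈ J) :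
    J = latticeIdeal (hJ.partialCharacter h1) := by
  classical
  have hle : latticeIdeal (hJ.partialCharacter h1) ≤ J := by
    refine Ideal.span_le.mpr ?_
    rintro _ ⟨u, v, h, rfl⟩
    exact hJ.binomial_mem ⟨expDiff u v, h⟩ rfl
  have hmem : ∀ (u v : σ →₀ ℕ) (c : Kˣ), monomial u (1 : K) - monomial v (c : K) ∈ J →
      monomial u (1 : K) - monomial v (c : K) ∈ latticeIdeal (hJ.partialCharacter h1) := by
    intro u v c hc
    have hd : expDiff u v ∈ binomialLattice J := ⟨u, v, c, rfl, hc⟩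
    refine Ideal.subset_span ⟨u, v, hd, ?_⟩
    rw [← hJ.binomialCoeff_eq h1 ⟨_, hd⟩ rfl hc]
    rfl
  refine le_antisymm ?_ hle
  intro f hf
  induction hn : f.support.card using Nat.strong_induction_on generalizing f with
  | _ n ih =>
    by_cases hf0 : f = 0
    · rw [hf0]
      exact Ideal.zero_mem _
    obtain ⟨u, hu⟩ := Finset.nonempty_iff_ne_empty.mpr (mt support_eq_empty.mp hf0)
    obtain ⟨v, hv, hvu, c, hc, hcJ⟩ := hterm f hf u hu
    -- Subtracting `b` cancels the term at `v` and alters only the one at `u`, already in the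
    -- support, so the number of terms drops.
    set b : MvPolynomial σ K := C (f.coeff v) * (monomial v (1 : K) - monomial u c) with hb
    have hbL : b ∈ latticeIdeal (hJ.partialCharacter h1) :=
      Ideal.mul_mem_left _ _ (hmem v u (Units.mk0 c hc) hcJ)
    have hsub : (f - b).support ⊆ f.support.erase v := by
      intro a ha
      rw [mem_support_iff] at ha
      have hav : a ≠ v := by
        rintro rfl
        apply ha
        simp [hb, coeff_C_mul, coeff_monomial, hvu.symm]
      refine Finset.mem_erase.mpr ⟨hav, mem_support_iff.mpr fun h0 => ha ?_⟩
      have hau : a ≠ u := by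
        rintro rfl
        exact mem_support_iff.mp hu h0
      simp [hb, coeff_C_mul, coeff_monomial, h0, hav.symm, hau.symm]
    have hlt : (f - b).support.card < n := by
      rw [← hn]
      exact (Finset.card_le_card hsub).trans_lt (Finset.card_erase_lt_of_mem hv)
    have := ih _ hlt (J.sub_mem hf (hle hbL)) rfl
    simpa using Ideal.add_mem _ this hbL

lemma exists_expDiff_eq [Finite σ] (d : σ → ℤ) : ∃ u v : σ →₀ ℕ, expDiff u v = d := by
  refine ⟨Finsupp.equivFunOnFinite.symm fun i => (d i).toNat,
    Finsupp.equivFunOnFinite.symm fun i => (-d i).toNat, ?_⟩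
  funext i
  simp only [expDiff, Finsupp.equivFunOnFinite_symm_apply_apply]
  omega

lemma lattice_le_binomialLattice [Finite σ] {J : Ideal (MvPolynomial σ K)} {τ : PartialCharacter σ K}
    (h : latticeIdeal τ ≤ J) : τ.lattice ≤ binomialLattice J := by
  intro d hd
  obtain ⟨u, v, rfl⟩ := exists_expDiff_eq d
  exact ⟨u, v, _, rfl, h (Ideal.subset_span ⟨u, v, hd, rfl⟩)⟩

lemma latticeRank_mono [Finite σ] {L L' : AddSubgroup (σ → ℤ)} (h : L ≤ L') :
    latticeRank L ≤ latticeRank L' := by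
  have : AddSubgroup.toIntSubmodule L ≤ AddSubgroup.toIntSubmodule L' := h
  exact Submodule.finrank_mono this

end Lattice

/-! ### Contracted colon ideals and witnesses -/

section Cellular

variable {σ K : Type*} [Field K]

lemma mem_of_monomial_mul_mem {I : Ideal (MvPolynomial σ K)} {a : σ →₀ ℕ}
    (ha : ∀ i ∉ cellularVars I, a i = 0) {f : MvPolynomial σ K}
    (h : monomial a (1 : K) * f ∈ I) : f ∈ I := by
  have hnzd : Ideal.Quotient.mk I (monomial a (1 : K)) ∈
      nonZeroDivisors (MvPolynomial σ K ⧸ I) := by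
    rw [monomial_eq, C_1, one_mul, Finsupp.prod, map_prod]
    refine Submonoid.prod_mem _ fun i hi => ?_
    rw [map_pow]
    refine Submonoid.pow_mem _ ?_ _
    by_contra hn
    exact Finsupp.mem_support_iff.mp hi (ha i hn)
  rw [← Ideal.Quotient.eq_zero_iff_mem, map_mul] at h
  rw [← Ideal.Quotient.eq_zero_iff_mem]
  exact (mul_left_mem_nonZeroDivisors_eq_zero_iff hnzd).mp h

lemma mem_contract_colon {I : Ideal (MvPolynomial σ K)} {Δ : Set σ} {w : σ →₀ ℕ}
    {f : MvPolynomial Δ K} :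
    f ∈ contract Δ (Submodule.colon I {monomial w (1 : K)}) ↔
      monomial w (1 : K) * rename (R := K) (Subtype.val : Δ → σ) f ∈ I := by
  rw [contract, Ideal.mem_comap, Submodule.mem_colon_singleton, smul_eq_mul, mul_comm]

lemma mapDomain_apply_of_notMem {Δ : Set σ} (a : Δ →₀ ℕ) {i : σ} (hi : i ∉ Δ) :
    a.mapDomain Subtype.val i = 0 :=
  Finsupp.mapDomain_of_notMem_range _ _ (by simpa using hi)

lemma isMonomialSaturated_contract_colon (I : Ideal (MvPolynomial σ K)) (w : σ →₀ ℕ) :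
    IsMonomialSaturated
      (contract (cellularVars I) (Submodule.colon I {monomial w (1 : K)})) := by
  intro a f h
  rw [mem_contract_colon] at h ⊢
  rw [map_mul, rename_monomial, mul_left_comm] at h
  exact mem_of_monomial_mul_mem (fun i hi => mapDomain_apply_of_notMem a hi) h

lemma monomial_mul_rename_support {Δ : Set σ} (w : σ →₀ ℕ) (f : MvPolynomial Δ K)
    (s : σ →₀ ℕ) : s ∈ (monomial w (1 : K) * rename (Subtype.val : Δ → σ) f).support ↔
      ∃ u ∈ f.support, s = w + u.mapDomain Subtype.val := by
  classical
  rw [mem_support_iff, coeff_monomial_mul']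
  constructor
  · intro h
    split_ifs at h with hw
    · rw [one_mul] at h
      obtain ⟨u, hu, hu0⟩ := coeff_rename_ne_zero _ _ _ h
      exact ⟨u, mem_support_iff.mpr hu0, by rw [hu, add_tsub_cancel_of_le hw]⟩
    · exact absurd rfl h
  · rintro ⟨u, hu, rfl⟩
    rw [if_pos le_self_add, add_tsub_cancel_left, one_mul,
      coeff_rename_mapDomain _ Subtype.val_injective]
    exact mem_support_iff.mp hu

/-- For a binomial ideal `I` and a monomial `x^w ∉ I`, the ideal `(I : x^w) ∩ K[ℕ^Δ]` is the
lattice ideal of a partial character on its lattice of binomial exponents. -/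
lemma IsBinomialIdeal.exists_contract_colon_eq_latticeIdeal {I : Ideal (MvPolynomial σ K)}
    (hI : IsBinomialIdeal I) {w : σ →₀ ℕ} (hw : monomial w (1 : K) ∉ I) :
    ∃ τ : PartialCharacter (cellularVars I) K,
      τ.lattice = binomialLattice
        (contract (cellularVars I) (Submodule.colon I {monomial w (1 : K)})) ∧
      contract (cellularVars I) (Submodule.colon I {monomial w (1 : K)}) = latticeIdeal τ := by
  have hsat := isMonomialSaturated_contract_colon I w
  have h1 : contract (cellularVars I) (Submodule.colon I {monomial w (1 : K)}) ≠ ⊤ := by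
    rw [Ne, Ideal.eq_top_iff_one, mem_contract_colon,
      map_one (rename (R := K) (Subtype.val : cellularVars I → σ)), mul_one]
    exact hw
  refine ⟨hsat.partialCharacter h1, rfl, hsat.eq_latticeIdeal h1 ?_⟩
  intro f hf u hu
  rw [mem_contract_colon] at hf
  -- Terms of `x^w f` are shifts by `w` of terms of `f`; a shifted term in `I` would put `x^w` in
  -- `I`, as variables in `Δ` cancel.
  have hnot : monomial (w + u.mapDomain Subtype.val) (1 : K) ∉ I := by
    intro h
    refine hw (mem_of_monomial_mul_mem (a := u.mapDomain Subtype.val)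
      (fun i hi => mapDomain_apply_of_notMem u hi) ?_)
    rwa [monomial_mul, one_mul, add_comm]
  obtain ⟨s, hs, hsu, c, hc, hmem⟩ := hI.exists_sub_mem hf hnot
    ((monomial_mul_rename_support w f _).mpr ⟨u, hu, rfl⟩)
  obtain ⟨v, hv, rfl⟩ := (monomial_mul_rename_support w f _).mp hs
  refine ⟨v, hv, fun h => hsu (by rw [h]), c, hc, ?_⟩
  rw [mem_contract_colon, map_sub, rename_monomial, rename_monomial, mul_sub, monomial_mul,
    monomial_mul, one_mul, one_mul]
  exact hmem

/-- Every term of a member of `Memb I` is divisible by a witness monomial of an embedded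
associated lattice. -/
lemma exists_le_of_mem_Memb {I : Ideal (MvPolynomial σ K)} {g : MvPolynomial σ K} (hg : g ∈ Memb I) {v : σ →₀ ℕ}
    (hv : v ∈ g.support) :
    ∃ (L : AddSubgroup (cellularVars I → ℤ)) (w : σ →₀ ℕ),
      IsEmbeddedLattice I L ∧ IsWitness I L w ∧ w ≤ v := by
  have hM : Memb I = Ideal.span ((fun s => monomial s (1 : K)) ''
      {w | ∃ L : AddSubgroup (cellularVars I → ℤ), IsEmbeddedLattice I L ∧ IsWitness I L w}) := by
    unfold Memb
    congr 1
    ext m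
    constructor
    · rintro ⟨L, w, h, h', rfl⟩
      exact ⟨w, ⟨L, h, h'⟩, rfl⟩
    · rintro ⟨w, ⟨L, h, h'⟩, rfl⟩
      exact ⟨L, w, h, h', rfl⟩
  rw [hM, mem_ideal_span_monomial_image] at hg
  obtain ⟨w, ⟨L, h, h'⟩, hle⟩ := hg v hv
  exact ⟨L, w, h, h', hle⟩

/-- A monomial outside the binomial ideal `I` which is proportional modulo `I` to a term of a
member of `Memb I` is itself in `Memb I`: the colon ideal can only grow, so the part of the
monomial in the nilpotent variables witnesses a lattice of at least the same rank. -/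
lemma monomial_mem_Memb [Finite σ] {I : Ideal (MvPolynomial σ K)} (hI : IsBinomialIdeal I)
    {μ : σ →₀ ℕ} (hμ : monomial μ (1 : K) ∉ I) {g : MvPolynomial σ K} (hg : g ∈ Memb I)
    {v : σ →₀ ℕ} (hv : v ∈ g.support) {c : K} (hc : c ≠ 0)
    (h : monomial v (1 : K) - monomial μ c ∈ I) : monomial μ (1 : K) ∈ Memb I := by
  classical
  obtain ⟨L, w, ⟨-, ρ, hρ, hrank⟩, ⟨-, τ, rfl, hτ⟩, hwv⟩ := exists_le_of_mem_Memb hg hv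
  set w' := μ.filter (· ∉ cellularVars I) with hw'
  set a := μ.filter (· ∈ cellularVars I) with ha
  have haw : a + w' = μ := Finsupp.filter_add_filter_not μ _
  have hμ_eq : monomial μ (1 : K) = monomial a 1 * monomial w' 1 := by
    rw [monomial_mul, one_mul, haw]
  have hw'I : monomial w' (1 : K) ∉ I := fun h' => hμ (hμ_eq ▸ I.mul_mem_left _ h')
  have hle : latticeIdeal τ ≤
      contract (cellularVars I) (Submodule.colon I {monomial w' (1 : K)}) := by
    rw [← hτ]
    intro f hf
    rw [mem_contract_colon] at hf ⊢
    refine mem_of_monomial_mul_mem (a := a)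
      (fun i hi => Finsupp.filter_apply_neg (· ∈ cellularVars I) μ hi) ?_
    rw [← mul_assoc, ← hμ_eq]
    -- Pass from `x^w f` to its multiple `x^v f`, then replace `x^v` by `c x^μ` modulo `I` and
    -- divide by `c`.
    have hvf := I.mul_mem_left (monomial (v - w) (1 : K)) hf
    rw [← mul_assoc, monomial_mul, one_mul, tsub_add_cancel_of_le hwv] at hvf
    have h2 := I.mul_mem_left (C c⁻¹)
      (I.sub_mem hvf (I.mul_mem_right (rename Subtype.val f) h))
    rwa [← sub_mul, sub_sub_cancel, ← mul_assoc, C_mul_monomial, inv_mul_cancel₀ hc] at h2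
  obtain ⟨τ', hτ'L, hτ'⟩ := hI.exists_contract_colon_eq_latticeIdeal hw'I
  have hwit : IsWitness I τ'.lattice w' :=
    ⟨fun i hi => Finsupp.filter_apply_neg (· ∉ cellularVars I) μ (not_not.mpr hi),
      τ', rfl, hτ'⟩
  have hlt : latticeRank ρ.lattice < latticeRank τ'.lattice :=
    hrank.trans_le (latticeRank_mono (hτ'L ▸ lattice_le_binomialLattice hle))
  rw [hμ_eq]
  exact Ideal.mul_mem_left _ _
    (Ideal.subset_span ⟨τ'.lattice, w', ⟨⟨w', hwit⟩, ρ, hρ, hlt⟩, hwit, rfl⟩)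

end Cellular

end CellularBinomial

theorem mainTheorem8 {K : Type*} [Field K] {n : ℕ}
    (I : Ideal (MvPolynomial (Fin n) K))
    (hbin : CellularBinomial.IsBinomialIdeal I)
    (hcell : CellularBinomial.IsCellular I)
    (μ : Fin n →₀ ℕ)
    (hμ : MvPolynomial.monomial μ (1 : K) ∈ I ⊔ CellularBinomial.Memb I) :
    MvPolynomial.monomial μ (1 : K) ∈ I ∨
      MvPolynomial.monomial μ (1 : K) ∈ CellularBinomial.Memb I := by
  rw [or_iff_not_imp_left]
  intro hμI
  obtain ⟨g, hg, v, hv, c, hc, hmem⟩ := hbin.exists_of_mem_sup hμI hμ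
  exact CellularBinomial.monomial_mem_Memb hbin hμI hg hv hc hmem
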